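/- Let $\mathbb{R}^\times=\mathbb{R}\setminus\{0\}$. A \emph{homogeneous symplectic manifold} $(\Sigma,\omega,h)$ is the total space $\Sigma$ of a (smooth) principal $\mathbb{R}^\times$-bundle with action $h$, together with a symplectic form $\omega$ such that $h_z^*\omega=z\,\omega$ for all $z\in\mathbb{R}^\times$. A submanifold is \emph{homogeneous} if it is $\mathbb{R}^\times$-invariant. Let $I\subseteq\mathbb{R}$ be an interval with more than one point. A family $(L_s)_{s\in I}$ of subsets of $\Sigma$ is a \emph{smooth family of homogeneous Lagrangian submanifolds} if every $L_s$ is a homogeneous (embedded) Lagrangian submanifold of $\Sigma$ and $L_I=\{(x,s)\in\Sigma\times I : x\in L_s\}$ is a submanifold of $\Sigma\times I$ on which the projection to $I$ is a surjective submersion. (If $I$ contains an end point, this means that locally $L_I$ is the intersection of $\Sigma\times I$ with a submanifold of $\Sigma\times\mathbb{R}$.) For $x\in L_{s}$, the \emph{normal variation} $\left[\frac{\partial L_s}{\partial s}(x)\right]\in T_x\Sigma/T_xL_{s}$ is the class of $\gamma'(s)$, where $\gamma$ is any smooth path defined on a neighbourhood of $s$ in $I$ with $\gamma(t)\in L_t$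 for all $t$ and $\gamma(s)=x$. The \emph{variation forms} of the family are the smooth $1$-forms $\xi_s\in\Omega^1(L_s)$ with $\xi_s(u)=\omega\left(\left[\frac{\partial L_s}{\partial s}(x)\right],u\right)$ for all $x\in L_s$ and $u\in T_xL_s$. **Proposition.** Let $(V,\omega_V,h^V)$ and $(W,\omega_W,h^W)$ be homogeneous symplectic manifolds and let $\phi:V\to W$ be a homogeneous symplectomorphism, i.e. a diffeomorphism with $\phi^*\omega_W=\omega_V$ and $\phi\circ h^V_z=h^W_z\circ\phi$ for all $z\in\mathbb{R}^\times$. Let $(L_s)_{s\in I}$ be a smooth family of homogeneous Lagrangian submanifolds of $V$. Then $\tilde L_s=\phi(L_s)$, $s\in I$, is a smooth family of homogeneous Lagrangian submanifolds of $W$. The normal variations and the variation forms $\xi_s$ of $(L_s)$ and $\tilde\xi_s$ of $(\tilde L_s)$ exist and are unique, all these forms are $1$-homogeneous, that is $(h^V_z)^*\xi_s=z\,\xi_s$ and $(h^W_z)^*\tilde\xi_s=z\,\tilde\xi_s$ for all $z\in\mathbb{R}^\times$, and $$\xi_s=\phi^*\tilde\xi_s\qquad\text{for all } s\in I.$$ 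-/

import Mathlib

open Set Topology Module
open scoped Manifold ContDiff

noncomputable section

/-! ### Submanifolds, tangent spaces of submanifolds, forms on submanifolds -/

section Submanifolds

variable {E : Type*} [NormedAddCommGroup E] [NormedSpace ℝ E] {H : Type*} [TopologicalSpace H]
  (I : ModelWithCorners ℝ E H) {M : Type*} [TopologicalSpace M] [ChartedSpace H M]
  {E' : Type*} [NormedAddCommGroup E'] [NormedSpace ℝ E'] {H' : Type*} [TopologicalSpace H']
  (I' : ModelWithCorners ℝ E' H') {M' : Type*} [TopologicalSpace M'] [ChartedSpace H' M']

/-- `S` is a `k`-dimensional (embedded) submanifold of the domain `D` of the manifold `M`: around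
each of its points there is a smooth chart of `M` in which `S` is the trace on `D` of a
`k`-dimensional linear subspace. For `D = univ` this is the usual definition of an embedded
submanifold by slice charts; `D` is only needed to speak of submanifolds of `Σ × J`, where `J` is an
interval which may contain its end points, inside `Σ × ℝ`. -/
def IsSubmanifoldIn (D : Set M) (k : ℕ) (S : Set M) : Prop :=
  S ⊆ D ∧ ∀ p ∈ S, ∃ φ ∈ IsManifold.maximalAtlas I ∞ M, p ∈ φ.source ∧
    ∃ F : Submodule ℝ E, finrank ℝ F = k ∧
      ∀ q ∈ φ.source, q ∈ D → (q ∈ S ↔ φ.extend I q ∈ F)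

/-- `γ` is a smooth (one-sided) curve in `S` which starts at `p`. -/
def IsCurveIn (S : Set M) (p : M) (γ : ℝ → M) : Prop :=
  γ 0 = p ∧ ∃ ε > 0, ContMDiffOn 𝓘(ℝ, ℝ) I ∞ γ (Ico 0 ε) ∧ ∀ t ∈ Ico 0 ε, γ t ∈ S

/-- The initial velocity of a curve. -/
def initialVelocity (γ : ℝ → M) : TangentSpace I (γ 0) :=
  mfderivWithin 𝓘(ℝ, ℝ) I γ (Ici 0) 0 (1 : ℝ)

/-- The tangent space `T_p S`, as a subspace of `T_p M`: the span of the velocities of the smooth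
curves in `S` which start at `p`. -/
def tangentSub (S : Set M) (p : M) : Submodule ℝ (TangentSpace I p) :=
  Submodule.span ℝ {v | ∃ γ : ℝ → M, IsCurveIn I S p γ ∧ v = initialVelocity I γ}

/-- The normal space `N_p S = T_p M / T_p S`. -/
abbrev SubNormalSpace (S : Set M) (p : M) : Type _ := TangentSpace I p ⧸ tangentSub I S p

/-- A (not necessarily smooth) `1`-form on `S`: a linear form on each `T_p S`, `p ∈ S`. -/
abbrev OneFormOn (S : Set M) : Type _ := ∀ p : S, tangentSub I S (p : M) →ₗ[ℝ] ℝ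

/-- A `1`-form on a submanifold `S` is smooth if around each point of `S` it is the restriction of
a smooth `1`-form of the ambient manifold, the latter being written `β` in a chart. -/
def IsSmoothOneFormOn {S : Set M} (α : OneFormOn I S) : Prop :=
  ∀ p : S, ∃ (O : Set E) (β : E → E →L[ℝ] ℝ),
    IsOpen O ∧ extChartAt I (p : M) p ∈ O ∧ ContDiffOn ℝ ∞ β O ∧
    ∀ q : S, (q : M) ∈ (extChartAt I (p : M)).source → extChartAt I (p : M) q ∈ O →
      ∀ u : tangentSub I S (q : M),
        α q u = β (extChartAt I (p : M) q) (mfderiv I 𝓘(ℝ, E) (extChartAt I (p : M)) q u)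

variable {I I'}

/-- The differential of a smooth map `f` with `f(S) ⊆ S'` maps `T_p S` into `T_{f(p)} S'`. -/
theorem mfderiv_mem_tangentSub {f : M → M'} (hf : ContMDiff I I' ∞ f) {S : Set M} {S' : Set M'}
    (hS : MapsTo f S S') {p : M} {v : TangentSpace I p} (hv : v ∈ tangentSub I S p) :
    mfderiv I I' f p v ∈ tangentSub I' S' (f p) := by
  have key : tangentSub I S p ≤
      (tangentSub I' S' (f p)).comap (mfderiv I I' f p).toLinearMap := by
    refine Submodule.span_le.2 ?_
    rintro _ ⟨γ, ⟨h0, ε, hε, hγ, hγS⟩, rfl⟩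
    subst h0
    refine Submodule.subset_span ⟨f ∘ γ, ⟨rfl, ε, hε, hf.comp_contMDiffOn hγ,
      fun t ht => hS (hγS t ht)⟩, ?_⟩
    have hγ0 : MDifferentiableWithinAt 𝓘(ℝ, ℝ) I γ (Ici 0) 0 :=
      ((hγ 0 ⟨le_rfl, hε⟩).mdifferentiableWithinAt (by simp)).mono_of_mem_nhdsWithin
        (Ico_mem_nhdsGE hε)
    have hu : UniqueMDiffWithinAt 𝓘(ℝ, ℝ) (Ici (0 : ℝ)) 0 :=
      (uniqueDiffOn_Ici (0 : ℝ) 0 self_mem_Ici).uniqueMDiffWithinAt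
    have hf0 : MDifferentiableAt I I' f (γ 0) := (hf (γ 0)).mdifferentiableAt (by simp)
    have := mfderiv_comp_mfderivWithin (I := 𝓘(ℝ, ℝ)) (I' := I) (I'' := I') (x := (0 : ℝ))
      (s := Ici 0) (f := γ) (g := f) hf0 hγ0 hu
    exact (congrArg (fun T : ℝ →L[ℝ] E' => T 1) this).symm
  exact key hv

/-- The pullback of a `1`-form on `S'` by a smooth map `f` with `f(S) ⊆ S'`,
`(f^*α)_p(u) = α_{f(p)}(df_p(u))`. -/
def pullbackOneForm {f : M → M'} (hf : ContMDiff I I' ∞ f) {S : Set M} {S' : Set M'}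
    (hS : MapsTo f S S') (α : OneFormOn I' S') : OneFormOn I S := fun p =>
  (α ⟨f p, hS p.2⟩).comp ((mfderiv I I' f (p : M)).toLinearMap.restrict
    (p := tangentSub I S (p : M)) (q := tangentSub I' S' (f p))
    fun _ hv => mfderiv_mem_tangentSub hf hS hv)

end Submanifolds

/-! ### Differential forms and symplectic forms -/

section Forms

variable {E : Type*} [NormedAddCommGroup E] [NormedSpace ℝ E]
  {M : Type*} [TopologicalSpace M] [ChartedSpace E M]
  {E' : Type*} [NormedAddCommGroup E'] [NormedSpace ℝ E']
  {M' : Type*} [TopologicalSpace M'] [ChartedSpace E' M']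

variable (E M) in
/-- A (not necessarily smooth) `k`-form on a manifold without boundary modelled on `E`. -/
abbrev FormOn (k : ℕ) : Type _ := ∀ x : M, TangentSpace 𝓘(ℝ, E) x [⋀^Fin k]→L[ℝ] ℝ

/-- The pullback `f^*Ω`. -/
def pullbackForm {k : ℕ} (f : M → M') (Ω : FormOn E' M' k) : FormOn E M k := fun x =>
  (Ω (f x)).compContinuousLinearMap (mfderiv 𝓘(ℝ, E) 𝓘(ℝ, E') f x)

/-- The form `Ω` written in the preferred chart at `x₀`, that is, its pullback by the inverse of
this chart. It is meaningful on the (open) target of the chart. -/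
def formInChart {k : ℕ} (Ω : FormOn E M k) (x₀ : M) : E → E [⋀^Fin k]→L[ℝ] ℝ :=
  pullbackForm (extChartAt 𝓘(ℝ, E) x₀).symm Ω

/-- Symplectic forms: smooth, closed and nondegenerate `2`-forms. -/
structure IsSymplecticForm (Ω : FormOn E M 2) : Prop where
  smooth : ∀ x₀ : M, ContDiffOn ℝ ∞ (formInChart Ω x₀) (extChartAt 𝓘(ℝ, E) x₀).target
  closed : ∀ x₀ : M, ∀ y ∈ (extChartAt 𝓘(ℝ, E) x₀).target, extDeriv (formInChart Ω x₀) y = 0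
  nondegenerate : ∀ (x : M) (v : TangentSpace 𝓘(ℝ, E) x), (∀ u, Ω x ![v, u] = 0) → v = 0

end Forms

/-! ### Homogeneous symplectic manifolds -/

section Homogeneous

variable (E : Type*) [NormedAddCommGroup E] [NormedSpace ℝ E]
  (P : Type*) [TopologicalSpace P] [ChartedSpace E P]
  (F : Type*) [NormedAddCommGroup F] [NormedSpace ℝ F]
  (B : Type*) [TopologicalSpace B] [ChartedSpace F B]

/-- A homogeneous manifold: a principal `ℝˣ`-bundle `τ : P → B`, where `h z` is the action of
`z ∈ ℝˣ` on `P`. -/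
structure HomogeneousManifold where
  h : ℝˣ → P → P
  h_one : ∀ p, h 1 p = p
  h_mul : ∀ z w p, h (z * w) p = h w (h z p)
  smooth_h : ContMDiff (𝓘(ℝ, E).prod 𝓘(ℝ, ℝ)) 𝓘(ℝ, E) ∞ (fun q : P × ℝˣ => h q.2 q.1)
  τ : P → B
  surjective_τ : Function.Surjective τ
  τ_h : ∀ z p, τ (h z p) = τ p
  /-- Local triviality: the restriction of `e` to `τ⁻¹(U)` is an equivariant diffeomorphism onto
  `U × ℝˣ` over `U`. -/
  locally_trivial : ∀ b : B, ∃ (U : Set B) (e : OpenPartialHomeomorph P (B × ℝˣ)),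
    IsOpen U ∧ b ∈ U ∧ e.source = τ ⁻¹' U ∧ e.target = U ×ˢ univ ∧
    ContMDiffOn 𝓘(ℝ, E) (𝓘(ℝ, F).prod 𝓘(ℝ, ℝ)) ∞ e e.source ∧
    ContMDiffOn (𝓘(ℝ, F).prod 𝓘(ℝ, ℝ)) 𝓘(ℝ, E) ∞ e.symm e.target ∧
    (∀ p ∈ e.source, (e p).1 = τ p) ∧
    ∀ p ∈ e.source, ∀ z, e (h z p) = ((e p).1, z * (e p).2)

/-- A homogeneous symplectic manifold: a homogeneous manifold with a symplectic form `Ω` such that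
`h_z^* Ω = z Ω` for all `z ∈ ℝˣ`. -/
structure HomogeneousSymplecticManifold extends HomogeneousManifold E P F B where
  Ω : FormOn E P 2
  symplectic : IsSymplecticForm Ω
  homogeneous : ∀ (z : ℝˣ) (x : P), pullbackForm (h z) Ω x = (z : ℝ) • Ω x

variable {E P F B}

theorem HomogeneousManifold.contMDiff_h (X : HomogeneousManifold E P F B) (z : ℝˣ) :
    ContMDiff 𝓘(ℝ, E) 𝓘(ℝ, E) ∞ (X.h z) :=
  X.smooth_h.comp (contMDiff_id.prodMk contMDiff_const)

/-- A homogeneous symplectomorphism: an equivariant diffeomorphism with `φ^* Ω_W = Ω_V`. -/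
structure IsHomogeneousSymplectomorphism
    {E' : Type*} [NormedAddCommGroup E'] [NormedSpace ℝ E']
    {P' : Type*} [TopologicalSpace P'] [ChartedSpace E' P']
    {F' : Type*} [NormedAddCommGroup F'] [NormedSpace ℝ F']
    {B' : Type*} [TopologicalSpace B'] [ChartedSpace F' B']
    (V : HomogeneousSymplecticManifold E P F B) (W : HomogeneousSymplecticManifold E' P' F' B')
    (φ : P ≃ₘ⟮𝓘(ℝ, E), 𝓘(ℝ, E')⟯ P') : Prop where
  equivariant : ∀ z p, φ (V.h z p) = W.h z (φ p)
  symplectic : ∀ x, pullbackForm φ W.Ω x = V.Ω x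

/-- Homogeneous Lagrangian submanifolds: `ℝˣ`-invariant submanifolds of half the dimension, on
whose tangent spaces the symplectic form vanishes. -/
structure IsHomogeneousLagrangian (X : HomogeneousSymplecticManifold E P F B) (L : Set P) :
    Prop where
  submanifold : ∃ n : ℕ, finrank ℝ E = 2 * n ∧ IsSubmanifoldIn 𝓘(ℝ, E) univ n L
  isotropic : ∀ x ∈ L, ∀ u ∈ tangentSub 𝓘(ℝ, E) L x, ∀ v ∈ tangentSub 𝓘(ℝ, E) L x,
    X.Ω x ![u, v] = 0
  invariant : ∀ z, MapsTo (X.h z) L L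

/-- A `1`-form on an `ℝˣ`-invariant submanifold `S` is `1`-homogeneous if `h_z^* α = z α` for all
`z ∈ ℝˣ`. -/
def IsOneHomogeneous (X : HomogeneousManifold E P F B) {S : Set P}
    (hS : ∀ z, MapsTo (X.h z) S S) (α : OneFormOn 𝓘(ℝ, E) S) : Prop :=
  ∀ z : ℝˣ, pullbackOneForm (X.contMDiff_h z) (hS z) α = (z : ℝ) • α

/-! ### Smooth families, normal variations, variation forms -/

/-- The total space `{(x, s) | s ∈ J, x ∈ L_s}` of a family indexed by `J ⊆ ℝ`, as a subset of
`P × ℝ`. -/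
def familyTotal {J : Set ℝ} (L : J → Set P) : Set (P × ℝ) :=
  {q | ∃ hs : q.2 ∈ J, q.1 ∈ L ⟨q.2, hs⟩}

/-- Smooth families of homogeneous Lagrangian submanifolds: the total space is a submanifold of
`P × J`, and its projection to `J` is a surjective submersion. -/
structure IsSmoothLagrangianFamily (X : HomogeneousSymplecticManifold E P F B) {J : Set ℝ}
    (L : J → Set P) : Prop where
  lagrangian : ∀ s, IsHomogeneousLagrangian X (L s)
  submanifold : ∃ d : ℕ,
    IsSubmanifoldIn (𝓘(ℝ, E).prod 𝓘(ℝ, ℝ)) {q : P × ℝ | q.2 ∈ J} d (familyTotal L)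
  surjective : ∀ s ∈ J, ∃ q ∈ familyTotal L, q.2 = s
  submersion : ∀ q ∈ familyTotal L, ∀ c : ℝ,
    ∃ v ∈ tangentSub (𝓘(ℝ, E).prod 𝓘(ℝ, ℝ)) (familyTotal L) q,
      mfderiv (𝓘(ℝ, E).prod 𝓘(ℝ, ℝ)) 𝓘(ℝ, ℝ) (Prod.snd : P × ℝ → ℝ) q v = c

/-- `γ` is an `L`-path through `x ∈ L_s`: a smooth path, defined on a neighbourhood of `s` in `J`,
with `γ(t) ∈ L_t` and `γ(s) = x`. -/
def IsLPath (E : Type*) [NormedAddCommGroup E] [NormedSpace ℝ E] {P : Type*} [TopologicalSpace P]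
    [ChartedSpace E P] {J : Set ℝ} (L : J → Set P) (s : J) (x : P) (γ : ℝ → P) : Prop :=
  γ s = x ∧ ∃ U ∈ 𝓝 (s : ℝ), ContMDiffOn 𝓘(ℝ, ℝ) 𝓘(ℝ, E) ∞ γ (J ∩ U) ∧
    ∀ (t : ℝ) (ht : t ∈ J), t ∈ U → γ t ∈ L ⟨t, ht⟩

/-- The velocity at time `s` of a path parametrized by `J`. -/
def pathVelocity (E : Type*) [NormedAddCommGroup E] [NormedSpace ℝ E] {P : Type*}
    [TopologicalSpace P] [ChartedSpace E P] {J : Set ℝ} (γ : ℝ → P) (s : J) :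
    TangentSpace 𝓘(ℝ, E) (γ s) :=
  mfderivWithin 𝓘(ℝ, ℝ) 𝓘(ℝ, E) γ J (s : ℝ) (1 : ℝ)

/-- `ν ∈ N_x L_s` is the normal variation at `x` of the family at time `s`: there are `L`-paths
through `x`, and `ν` is the class of the velocity of every one of them. -/
def IsNormalVariation {J : Set ℝ} (L : J → Set P) (s : J) (x : P)
    (ν : SubNormalSpace 𝓘(ℝ, E) (L s) x) : Prop :=
  (∃ γ, IsLPath E L s x γ) ∧
    ∀ γ, IsLPath E L s x γ → Submodule.Quotient.mk (pathVelocity E γ s) = ν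

/-- The `ξ_s` are the variation forms of the family: smooth `1`-forms on the `L_s` with
`ξ_s(u) = Ω([∂L_s/∂s], u)` for all `u ∈ T_x L_s`, for any representative of the normal
variation `[∂L_s/∂s] ∈ N_x L_s`. -/
structure IsVariationForms (X : HomogeneousSymplecticManifold E P F B) {J : Set ℝ}
    (L : J → Set P) (ξ : ∀ s : J, OneFormOn 𝓘(ℝ, E) (L s)) : Prop where
  smooth : ∀ s, IsSmoothOneFormOn 𝓘(ℝ, E) (ξ s)
  variation : ∀ (s : J) (x : L s), ∃ ν : SubNormalSpace 𝓘(ℝ, E) (L s) (x : P),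
    IsNormalVariation L s x ν ∧
    ∀ v : TangentSpace 𝓘(ℝ, E) (x : P), Submodule.Quotient.mk v = ν →
      ∀ u : tangentSub 𝓘(ℝ, E) (L s) (x : P), X.Ω x ![v, u] = ξ s x u

end Homogeneous

end

/-! Naturality is formal once the normal variation is known to exist: a map `f` carrying one family
into another carries paths of the first to paths of the second and transforms their velocities by
its differential, so `f^*Ω' = c Ω` forces `f^*ξ'_s = c ξ_s` (`IsVariationForms.pullbackOneForm_eq`).
With `f = φ`, `c = 1` this is the asserted equality; with `f = h_z`, `c = z` and the same family on
both sides it is homogeneity.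

The work lies in existence. Near a point of the total space there is a chart that straightens the
total space to a linear subspace `F` and, after a shear, also turns time into a linear form `ℓ`
(`AdaptedChart.nonempty`). In it, the straight lines along some `v ∈ F` with `ℓ v = 1` are paths in
the family, and their velocities form a smooth vector field. The difference of the velocities of two
paths through a point corresponds to a vector of `F` in the kernel of `ℓ`; the line in that
direction stays at time `s`, so the difference is tangent to `L_s`
(`AdaptedChart.pathVelocity_sub_mem`). Since `L_s` is isotropic, `Ω(velocity, ·)` on `T L_s` does
not depend on the path. -/

noncomputable section

/-! ### Inverse functions and velocities of curves in charts. -/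

/-- The inverse function theorem on an open set, with smoothness on the whole domain of the
resulting diffeomorphism. -/
theorem exists_openPartialHomeomorph_of_contDiffOn
    {G : Type*} [NormedAddCommGroup G] [NormedSpace ℝ G] [CompleteSpace G]
    {f : G → G} {U : Set G} (hU : IsOpen U) (hf : ContDiffOn ℝ ∞ f U) {a : G} (ha : a ∈ U)
    {f' : G ≃L[ℝ] G} (hf' : HasFDerivAt f (f' : G →L[ℝ] G) a) :
    ∃ e : OpenPartialHomeomorph G G, a ∈ e.source ∧ e.source ⊆ U ∧ (∀ z, e z = f z) ∧
      ContDiffOn ℝ ∞ e.symm e.target := by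
  have hfa : ContDiffAt ℝ ∞ f a := hf.contDiffAt (hU.mem_nhds ha)
  let e₀ := hfa.toOpenPartialHomeomorph f hf' (by simp)
  have he₀ : ∀ z, e₀ z = f z := fun z => rfl
  have hcont : ContinuousOn (fderiv ℝ f) U := hf.continuousOn_fderiv_of_isOpen hU (by simp)
  -- Invertibility of the derivative is an open condition; restricting to it makes the inverse
  -- smooth on the whole target and not only at the image of `a`.
  have hV : IsOpen (U ∩ fderiv ℝ f ⁻¹' range ((↑) : (G ≃L[ℝ] G) → G →L[ℝ] G)) :=
    hcont.isOpen_inter_preimage hU ContinuousLinearEquiv.isOpen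
  refine ⟨e₀.restrOpen _ hV, ⟨hfa.mem_toOpenPartialHomeomorph_source hf' (by simp), ha, f', ?_⟩,
    fun z hz => hz.2.1, he₀, ?_⟩
  · exact hf'.fderiv.symm
  · intro w hw
    have hw' := (e₀.restrOpen _ hV).map_target hw
    obtain ⟨-, hzU, g, hg⟩ := hw'
    refine (OpenPartialHomeomorph.contDiffAt_symm (f₀' := g) _ hw ?_ ?_).contDiffWithinAt
    · rw [hg]
      exact ((hf.contDiffAt (hU.mem_nhds hzU)).differentiableAt (by simp)).hasFDerivAt
    · exact hf.contDiffAt (hU.mem_nhds hzU)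

section Curves

variable {E : Type*} [NormedAddCommGroup E] [NormedSpace ℝ E] {H : Type*} [TopologicalSpace H]
  {I : ModelWithCorners ℝ E H} {M : Type*} [TopologicalSpace M] [ChartedSpace H M]

/-- The velocity of a curve, computed in the preferred chart. -/
theorem hasDerivWithinAt_extChartAt_comp {γ : ℝ → M} {S : Set ℝ} {t : ℝ} {x : M} (hx : γ t = x)
    (h : MDifferentiableWithinAt 𝓘(ℝ, ℝ) I γ S t) :
    HasDerivWithinAt (extChartAt I x ∘ γ : ℝ → E)
      ((mfderivWithin 𝓘(ℝ, ℝ) I γ S t : ℝ →L[ℝ] E) 1) S t := by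
  subst hx
  have := h.hasMFDerivWithinAt.2
  simp only [writtenInExtChartAt, extChartAt_model_space_eq_id, PartialEquiv.refl_coe,
    PartialEquiv.refl_symm, Function.comp_id, id_eq, preimage_id, modelWithCornersSelf_coe,
    range_id, inter_univ] at this
  obtain ⟨T, hT⟩ : ∃ T : ℝ →L[ℝ] E, T = mfderivWithin 𝓘(ℝ, ℝ) I γ S t := ⟨_, rfl⟩
  have h' : HasFDerivWithinAt (extChartAt I (γ t) ∘ γ : ℝ → E) T S t := hT ▸ this
  have h'' := h'.hasDerivWithinAt
  rw [hT] at h''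
  exact h''

theorem IsCurveIn.mdifferentiableWithinAt {S : Set M} {p : M} {γ : ℝ → M} (h : IsCurveIn I S p γ) :
    MDifferentiableWithinAt 𝓘(ℝ, ℝ) I γ (Ici 0) 0 := by
  obtain ⟨-, ε, hε, hγ, -⟩ := h
  exact ((hγ 0 ⟨le_rfl, hε⟩).mdifferentiableWithinAt (by simp)).mono_of_mem_nhdsWithin
    (Ico_mem_nhdsGE hε)

theorem IsCurveIn.eventually_mem {S : Set M} {p : M} {γ : ℝ → M} (h : IsCurveIn I S p γ) :
    ∀ᶠ t in 𝓝[Ici (0 : ℝ)] 0, γ t ∈ S := by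
  obtain ⟨-, ε, hε, -, hS⟩ := h
  filter_upwards [Ico_mem_nhdsGE hε] with t ht using hS t ht

end Curves

/-! ### Charts straightening both the total space and time. -/

section Adapted

variable {E : Type*} [NormedAddCommGroup E] [NormedSpace ℝ E]
  {P : Type*} [TopologicalSpace P] [ChartedSpace E P]

/-- A chart of `P × ℝ` around `(x, s)`, written in the preferred chart of `P` at `x`, in which the
total space of the family `L` is the trace of the linear subspace `F`, and in which the projection
to `ℝ` is the linear form `ℓ`, which does not vanish on `F`. -/
structure AdaptedChart (E : Type*) [NormedAddCommGroup E] [NormedSpace ℝ E] {P : Type*}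
    [TopologicalSpace P] [ChartedSpace E P] {J : Set ℝ} (L : J → Set P) (s : J) (x : P) where
  Θ : OpenPartialHomeomorph (E × ℝ) (E × ℝ)
  smooth : ContDiffOn ℝ ∞ Θ Θ.source
  smooth_symm : ContDiffOn ℝ ∞ Θ.symm Θ.target
  mem : (extChartAt 𝓘(ℝ, E) x x, (s : ℝ)) ∈ Θ.source
  source_sub : ∀ q ∈ Θ.source, q.1 ∈ (extChartAt 𝓘(ℝ, E) x).target
  F : Submodule ℝ (E × ℝ)
  ℓ : E × ℝ →L[ℝ] ℝ
  v : E × ℝ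
  v_mem : v ∈ F
  ℓ_v : ℓ v = 1
  ℓ_Θ : ∀ q ∈ Θ.source, ℓ (Θ q) = q.2
  slice : ∀ q ∈ Θ.source, ∀ h : q.2 ∈ J,
    (extChartAt 𝓘(ℝ, E) x).symm q.1 ∈ L ⟨q.2, h⟩ ↔ Θ q ∈ F

/-- A chart in which the total space is the trace of a linear subspace `F` that is transverse to
the time slice can be deformed into an adapted one. -/
theorem AdaptedChart.nonempty_of_slice [FiniteDimensional ℝ E] {J : Set ℝ} {L : J → Set P} {s : J}
    {x : P} (Θ : OpenPartialHomeomorph (E × ℝ) (E × ℝ))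
    (smooth : ContDiffOn ℝ ∞ Θ Θ.source) (smooth_symm : ContDiffOn ℝ ∞ Θ.symm Θ.target)
    (mem : (extChartAt 𝓘(ℝ, E) x x, (s : ℝ)) ∈ Θ.source)
    (source_sub : ∀ q ∈ Θ.source, q.1 ∈ (extChartAt 𝓘(ℝ, E) x).target)
    {F : Submodule ℝ (E × ℝ)}
    (slice : ∀ q ∈ Θ.source, ∀ h : q.2 ∈ J,
      (extChartAt 𝓘(ℝ, E) x).symm q.1 ∈ L ⟨q.2, h⟩ ↔ Θ q ∈ F)
    {v : E × ℝ} (hv : v ∈ F)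
    (hv1 : (fderiv ℝ Θ.symm (Θ (extChartAt 𝓘(ℝ, E) x x, (s : ℝ))) v).2 = 1) :
    Nonempty (AdaptedChart E L s x) := by
  set z₀ := Θ (extChartAt 𝓘(ℝ, E) x x, (s : ℝ)) with hz₀
  have hz₀t : z₀ ∈ Θ.target := Θ.map_source mem
  let ℓ : E × ℝ →L[ℝ] ℝ := (ContinuousLinearMap.snd ℝ E ℝ).comp (fderiv ℝ Θ.symm z₀)
  have hℓv : ℓ v = 1 := hv1
  -- A shear along `v`. It preserves `F` because `v ∈ F`; it turns time into `ℓ` because `ℓ v = 1`;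
  -- and its derivative at `z₀` is the identity because `ℓ` is the derivative of time there.
  let A : E × ℝ → E × ℝ := fun z => z + ((Θ.symm z).2 - ℓ z) • v
  have hA : ContDiffOn ℝ ∞ A Θ.target :=
    contDiffOn_id.add (((contDiff_snd.comp_contDiffOn smooth_symm).sub
      ℓ.contDiff.contDiffOn).smul contDiffOn_const)
  have hA' : HasFDerivAt A ((ContinuousLinearEquiv.refl ℝ (E × ℝ) : (E × ℝ) ≃L[ℝ] (E × ℝ)) :
      E × ℝ →L[ℝ] E × ℝ) z₀ := by
    have h1 : HasFDerivAt Θ.symm (fderiv ℝ Θ.symm z₀) z₀ :=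
      ((smooth_symm.contDiffAt (Θ.open_target.mem_nhds hz₀t)).differentiableAt
        (by simp)).hasFDerivAt
    have h2 : HasFDerivAt (fun z => (Θ.symm z).2 - ℓ z) (ℓ - ℓ) z₀ :=
      ((ContinuousLinearMap.snd ℝ E ℝ).hasFDerivAt.comp z₀ h1).sub ℓ.hasFDerivAt
    have h3 := (hasFDerivAt_id z₀).add (h2.smul_const v)
    refine h3.congr_fderiv ?_
    ext z <;> simp
  obtain ⟨e, hea, heU, hef, hes⟩ :=
    exists_openPartialHomeomorph_of_contDiffOn Θ.open_target hA hz₀t hA'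
  have hℓA : ∀ z, ℓ (A z) = (Θ.symm z).2 := fun z => by
    simp only [A, map_add, map_smul, hℓv, smul_eq_mul]; ring
  have hAF : ∀ z, A z ∈ F ↔ z ∈ F := fun z =>
    Submodule.add_mem_iff_left F (F.smul_mem _ hv)
  exact ⟨{
    Θ := Θ.trans e
    smooth := by
      have : ContDiffOn ℝ ∞ e e.source := (hA.mono heU).congr fun z _ => hef z
      exact this.comp (smooth.mono fun q hq => hq.1) fun q hq => hq.2
    smooth_symm := smooth_symm.comp (hes.mono fun q hq => hq.1) fun q hq => hq.2
    mem := ⟨mem, hea⟩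
    source_sub := fun q hq => source_sub q hq.1
    F := F
    ℓ := ℓ
    v := v
    v_mem := hv
    ℓ_v := hℓv
    ℓ_Θ := fun q hq => by
      rw [OpenPartialHomeomorph.trans_apply, hef, hℓA, Θ.left_inv hq.1]
    slice := fun q hq h => by
      rw [slice q hq.1 h, OpenPartialHomeomorph.trans_apply, hef, hAF] }⟩

/-- If the curve `g` lies in a finite-dimensional subspace, then so does its derivative. -/
theorem HasDerivWithinAt.mem_of_forall_mem {G : Type*} [NormedAddCommGroup G] [NormedSpace ℝ G]
    [FiniteDimensional ℝ G] {F : Submodule ℝ G} {g : ℝ → G} {g' : G} {S : Set ℝ} {t : ℝ}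
    (hg : HasDerivWithinAt g g' S t) (hS : UniqueDiffWithinAt ℝ S t) (ht : t ∈ S)
    (hF : ∀ᶠ r in 𝓝[S] t, g r ∈ F) : g' ∈ F := by
  by_contra hg'
  -- A functional separating `g'` from `F` vanishes along the curve near `t`, hence on its
  -- derivative.
  obtain ⟨f, hf, hFf⟩ := Submodule.exists_le_ker_of_notMem hg'
  have h1 : HasDerivWithinAt (fun r => f (g r)) (f g') S t :=
    (f.toContinuousLinearMap.hasFDerivAt (x := g t)).comp_hasDerivWithinAt t hg
  have h2 : HasDerivWithinAt (fun r => f (g r)) 0 S t := by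
    refine (hasDerivWithinAt_const t S (0 : ℝ)).congr_of_eventuallyEq_of_mem ?_ ht
    filter_upwards [hF] with r hr
    exact hFf hr
  exact hf (hS.eq_deriv _ h1 h2)

/-- The submersion condition supplies the transverse direction: the slice chart maps tangent vectors
of the total space into `F`, in particular one with time component `1`. -/
theorem AdaptedChart.nonempty [FiniteDimensional ℝ E] [IsManifold 𝓘(ℝ, E) ∞ P]
    {F : Type*} [NormedAddCommGroup F] [NormedSpace ℝ F]
    {B : Type*} [TopologicalSpace B] [ChartedSpace F B]
    {X : HomogeneousSymplecticManifold E P F B} {J : Set ℝ} {L : J → Set P}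
    (hL : IsSmoothLagrangianFamily X L) (s : J) (x : L s) :
    Nonempty (AdaptedChart E L s (x : P)) := by
  obtain ⟨d, -, hd⟩ := hL.submanifold
  have hp : ((x : P), (s : ℝ)) ∈ familyTotal L := ⟨s.2, x.2⟩
  obtain ⟨φ, hφ, hpφ, F, -, hF⟩ := hd _ hp
  set p : P × ℝ := ((x : P), (s : ℝ)) with hpdef
  let c' : OpenPartialHomeomorph (P × ℝ) (ModelProd E ℝ) := chartAt (ModelProd E ℝ) p
  let c : OpenPartialHomeomorph (P × ℝ) (E × ℝ) := c'
  have hc : c' ∈ IsManifold.maximalAtlas (𝓘(ℝ, E).prod 𝓘(ℝ, ℝ)) ∞ (P × ℝ) :=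
    IsManifold.chart_mem_maximalAtlas p
  -- `Θ` is the transition from the preferred product chart, whose second coordinate is time, to the
  -- slice chart.
  let φ' : OpenPartialHomeomorph (P × ℝ) (E × ℝ) := φ
  let Θ : OpenPartialHomeomorph (E × ℝ) (E × ℝ) := c.symm.trans φ'
  have hΘ : ContDiffOn ℝ ∞ Θ Θ.source := by
    have := ModelWithCorners.contDiffOn_extendCoordChange hc hφ
    rw [ModelWithCorners.extendCoordChange_source] at this
    rw [OpenPartialHomeomorph.trans_source]
    simp [ModelWithCorners.extendCoordChange] at this
    exact this
  have hΘs : ContDiffOn ℝ ∞ Θ.symm Θ.target := by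
    have := ModelWithCorners.contDiffOn_extendCoordChange hφ hc
    rw [ModelWithCorners.extendCoordChange_source] at this
    rw [OpenPartialHomeomorph.trans_target]
    simp [ModelWithCorners.extendCoordChange] at this
    exact this
  have hpc : p ∈ c.source := mem_chart_source (ModelProd E ℝ) p
  have hcp : (extChartAt 𝓘(ℝ, E) (x : P) x, (s : ℝ)) = c p := by
    rfl
  have hcext : ∀ q, extChartAt (𝓘(ℝ, E).prod 𝓘(ℝ, ℝ)) p q = c q := fun q => by
    rfl
  obtain ⟨z₀, hz₀⟩ : ∃ z, z = c p := ⟨_, rfl⟩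
  have hmem : z₀ ∈ Θ.source := hz₀ ▸ ⟨c.map_source hpc, by
    simpa [c.left_inv hpc] using hpφ⟩
  have hΘc : ∀ q ∈ c.source, Θ (c q) = φ q := fun q hq => by
    simp only [Θ, OpenPartialHomeomorph.trans_apply, c.left_inv hq, φ']
  have hΘ' : HasFDerivAt Θ (fderiv ℝ Θ z₀) z₀ :=
    ((hΘ.contDiffAt (Θ.open_source.mem_nhds hmem)).differentiableAt (by simp)).hasFDerivAt
  have hΘs' : HasFDerivAt Θ.symm (fderiv ℝ Θ.symm (Θ z₀)) (Θ z₀) :=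
    ((hΘs.contDiffAt (Θ.open_target.mem_nhds (Θ.map_source hmem))).differentiableAt
      (by simp)).hasFDerivAt
  have hinv : ∀ v, fderiv ℝ Θ.symm (Θ z₀) (fderiv ℝ Θ z₀ v) = v := fun v => by
    have h1 := hΘs'.comp z₀ hΘ'
    have h2 : HasFDerivAt (Θ.symm ∘ Θ) (ContinuousLinearMap.id ℝ (E × ℝ)) z₀ :=
      (hasFDerivAt_id z₀).congr_of_eventuallyEq (Θ.eventually_left_inverse hmem)
    exact congrArg (fun T : E × ℝ →L[ℝ] E × ℝ => T v) (h1.unique h2)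
  -- The tangent space is spanned by velocities, so it suffices to treat curves, whose images under
  -- the slice chart run in `F`.
  have htan : ∀ v ∈ tangentSub (𝓘(ℝ, E).prod 𝓘(ℝ, ℝ)) (familyTotal L) p,
      fderiv ℝ Θ z₀ v ∈ F := by
    suffices tangentSub (𝓘(ℝ, E).prod 𝓘(ℝ, ℝ)) (familyTotal L) p ≤
      F.comap (fderiv ℝ Θ z₀).toLinearMap from this
    refine Submodule.span_le.2 ?_
    rintro _ ⟨γ, hγ, rfl⟩
    have h1 := hasDerivWithinAt_extChartAt_comp hγ.1 hγ.mdifferentiableWithinAt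
    have hγ0 : (extChartAt (𝓘(ℝ, E).prod 𝓘(ℝ, ℝ)) p ∘ γ) 0 = z₀ := by
      rw [Function.comp_apply, hγ.1, hcext, hz₀]
    rw [← hγ0] at hΘ'
    have h2 := hΘ'.comp_hasDerivWithinAt (0 : ℝ) h1
    rw [hγ0] at h2
    refine h2.mem_of_forall_mem (uniqueDiffOn_Ici (0 : ℝ) 0 self_mem_Ici) self_mem_Ici ?_
    have hcont := hγ.mdifferentiableWithinAt.continuousWithinAt
    have hopen : c.source ∩ φ.source ∈ 𝓝 (γ 0) := by
      rw [hγ.1]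
      exact (c.open_source.inter φ.open_source).mem_nhds ⟨hpc, hpφ⟩
    filter_upwards [hcont hopen, hγ.eventually_mem] with t ht htS
    rw [Function.comp_apply, Function.comp_apply, hcext, hΘc _ ht.1]
    exact (hF _ ht.2 htS.1).1 htS
  obtain ⟨v₀, hv₀, hv₁⟩ := hL.submersion p hp 1
  rw [mfderiv_snd] at hv₁
  refine AdaptedChart.nonempty_of_slice Θ hΘ hΘs (by rw [hcp, ← hz₀]; exact hmem) ?_ ?_ (htan v₀ hv₀) ?_
  · intro q hq
    have h1 : q ∈ c.target := hq.1
    have h2 : c'.target = (chartAt E (x : P)).target ×ˢ univ := by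
      simp only [c', hpdef, prodChartedSpace_chartAt, OpenPartialHomeomorph.prod_target,
        chartAt_self_eq, OpenPartialHomeomorph.refl_target]
    have h3 : q ∈ (chartAt E (x : P)).target ×ˢ (univ : Set ℝ) := h2 ▸ h1
    simpa [extChartAt] using h3.1
  · intro q hq h
    have h1 : c.symm q = ((extChartAt 𝓘(ℝ, E) (x : P)).symm q.1, q.2) := rfl
    have h2 := hF (c.symm q) hq.2 (by rw [h1]; exact h)
    have h3 : φ.extend (𝓘(ℝ, E).prod 𝓘(ℝ, ℝ)) (c.symm q) = Θ q := rfl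
    rw [h3, h1] at h2
    rw [← h2]
    exact ⟨fun h' => ⟨h, h'⟩, fun h' => h'.2⟩
  · rw [hcp, ← hz₀]
    exact (congrArg Prod.snd (hinv v₀)).trans hv₁

end Adapted

/-! ### Curves given in a chart. -/

section ChartCurves

variable {E : Type*} [NormedAddCommGroup E] [NormedSpace ℝ E]
  {P : Type*} [TopologicalSpace P] [ChartedSpace E P] [IsManifold 𝓘(ℝ, E) ∞ P]

/-- The velocity of a curve that is given in a chart. -/
theorem mfderivWithin_extChartAt_symm_comp {x : P} {k : ℝ → E} {k' : E} {S : Set ℝ} {t : ℝ}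
    (hk : HasDerivWithinAt k k' S t) (ht : k t ∈ (extChartAt 𝓘(ℝ, E) x).target)
    (hS : UniqueDiffWithinAt ℝ S t) :
    mfderivWithin 𝓘(ℝ, ℝ) 𝓘(ℝ, E) ((extChartAt 𝓘(ℝ, E) x).symm ∘ k) S t (1 : ℝ) =
      mfderiv 𝓘(ℝ, E) 𝓘(ℝ, E) (extChartAt 𝓘(ℝ, E) x).symm (k t) k' := by
  have h1 : MDifferentiableAt 𝓘(ℝ, E) 𝓘(ℝ, E) (extChartAt 𝓘(ℝ, E) x).symm (k t) :=
    ((contMDiffOn_extChartAt_symm (n := ∞) x).contMDiffAt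
      ((isOpen_extChartAt_target x).mem_nhds ht)).mdifferentiableAt (by simp)
  have h2 : HasMFDerivWithinAt 𝓘(ℝ, ℝ) 𝓘(ℝ, E) k S t
      (ContinuousLinearMap.toSpanSingleton ℝ k') :=
    hk.hasFDerivWithinAt.hasMFDerivWithinAt
  have h3 := (h1.hasMFDerivAt.comp_hasMFDerivWithinAt t h2).mfderivWithin hS.uniqueMDiffWithinAt
  rw [h3]
  exact congrArg (mfderiv 𝓘(ℝ, E) 𝓘(ℝ, E) (extChartAt 𝓘(ℝ, E) x).symm (k t))
    (ContinuousLinearMap.toSpanSingleton_apply_one ℝ k')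

theorem ContDiffOn.contMDiffOn_extChartAt_symm_comp {x : P} {k : ℝ → E} {S : Set ℝ}
    (hk : ContDiffOn ℝ ∞ k S) (hS : ∀ t ∈ S, k t ∈ (extChartAt 𝓘(ℝ, E) x).target) :
    ContMDiffOn 𝓘(ℝ, ℝ) 𝓘(ℝ, E) ∞ ((extChartAt 𝓘(ℝ, E) x).symm ∘ k) S :=
  (contMDiffOn_extChartAt_symm x).comp hk.contMDiffOn hS

end ChartCurves

/-! ### Paths in the family and the normal variation. -/

namespace AdaptedChart

variable {E : Type*} [NormedAddCommGroup E] [NormedSpace ℝ E]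
  {P : Type*} [TopologicalSpace P] [ChartedSpace E P]
  {J : Set ℝ} {L : J → Set P} {s : J} {x : P} (A : AdaptedChart E L s x)

theorem snd_symm {z : E × ℝ} (hz : z ∈ A.Θ.target) : (A.Θ.symm z).2 = A.ℓ z := by
  have := A.ℓ_Θ _ (A.Θ.map_target hz)
  rw [A.Θ.right_inv hz] at this
  exact this.symm

/-- The domain of the variation field. -/
def domain : Set E := {e | (e, (s : ℝ)) ∈ A.Θ.source}

theorem isOpen_domain : IsOpen A.domain :=
  A.Θ.open_source.preimage (by fun_prop)

theorem domain_subset : A.domain ⊆ (extChartAt 𝓘(ℝ, E) x).target := fun _ he =>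
  A.source_sub _ he

/-- A vector field along the slice `t = s`, written in the chart, which represents the normal
variation. -/
def field (e : E) : E := (fderiv ℝ A.Θ.symm (A.Θ (e, (s : ℝ))) A.v).1

/-- The source of the smoothness of the variation forms: the same direction `v` is used at all
nearby points. -/
theorem contDiffOn_field : ContDiffOn ℝ ∞ A.field A.domain := by
  have h1 : ContDiffOn ℝ ∞ (fun e : E => A.Θ (e, (s : ℝ))) A.domain :=
    A.smooth.comp (by fun_prop) fun e he => he
  have h2 : ContDiffOn ℝ ∞ (fderiv ℝ A.Θ.symm) A.Θ.target :=
    A.smooth_symm.fderiv_of_isOpen A.Θ.open_target (by simp)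
  have h3 := h2.comp h1 fun e he => A.Θ.map_source he
  exact contDiff_fst.comp_contDiffOn (h3.clm_apply contDiffOn_const)

/-- The curve which is, in the adapted chart, the straight line from `z₀` with direction `u`. -/
def line (z₀ u : E × ℝ) (t : ℝ) : E := (A.Θ.symm (z₀ + t • u)).1

theorem isOpen_line (z₀ u : E × ℝ) : IsOpen {t : ℝ | z₀ + t • u ∈ A.Θ.target} :=
  A.Θ.open_target.preimage (by fun_prop)

theorem contDiffOn_line (z₀ u : E × ℝ) :
    ContDiffOn ℝ ∞ (A.line z₀ u) {t | z₀ + t • u ∈ A.Θ.target} :=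
  contDiff_fst.comp_contDiffOn (A.smooth_symm.comp (by fun_prop) fun _ ht => ht)

theorem hasDerivAt_line {z₀ u : E × ℝ} (hz₀ : z₀ ∈ A.Θ.target) :
    HasDerivAt (A.line z₀ u) (fderiv ℝ A.Θ.symm z₀ u).1 0 := by
  have h1 : HasFDerivAt A.Θ.symm (fderiv ℝ A.Θ.symm z₀) (z₀ + (0 : ℝ) • u) := by
    rw [zero_smul, add_zero]
    exact ((A.smooth_symm.contDiffAt (A.Θ.open_target.mem_nhds hz₀)).differentiableAt
      (by simp)).hasFDerivAt
  have h2 : HasDerivAt (fun t : ℝ => z₀ + t • u) u 0 := by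
    simpa using ((hasDerivAt_id (0 : ℝ)).smul_const u).const_add z₀
  exact ((ContinuousLinearMap.fst ℝ E ℝ).hasFDerivAt (x := A.Θ.symm (z₀ + (0 : ℝ) • u))).comp_hasDerivAt
    (0 : ℝ) (h1.comp_hasDerivAt (0 : ℝ) h2)

theorem line_mem_target {z₀ u : E × ℝ} {t : ℝ} (ht : z₀ + t • u ∈ A.Θ.target) :
    A.line z₀ u t ∈ (extChartAt 𝓘(ℝ, E) x).target :=
  A.source_sub _ (A.Θ.map_target ht)

/-- Time is affine along a line in the adapted chart. Two cases are used: `ℓ u = 1` gives paths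
moving through the family, `ℓ u = 0` gives curves inside a single member. -/
theorem line_mem {z₀ u : E × ℝ} {t : ℝ} (ht : z₀ + t • u ∈ A.Θ.target) (hz₀ : z₀ ∈ A.F)
    (hu : u ∈ A.F) {r : ℝ} (hr : r = A.ℓ z₀ + t * A.ℓ u) (hJ : r ∈ J) :
    (extChartAt 𝓘(ℝ, E) x).symm (A.line z₀ u t) ∈ L ⟨r, hJ⟩ := by
  have h1 := A.snd_symm ht
  have h2 : (A.Θ.symm (z₀ + t • u)).2 = r := by
    rw [h1, hr]; simp
  subst h2
  refine (A.slice _ (A.Θ.map_target ht) hJ).2 ?_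
  rw [A.Θ.right_inv ht]
  exact A.F.add_mem hz₀ (A.F.smul_mem _ hu)

variable [IsManifold 𝓘(ℝ, E) ∞ P]

/-- Near `x` there are paths in the family whose velocity is given by the variation field. -/
theorem exists_isLPath (hJ : UniqueDiffOn ℝ J) {e : E} (he : e ∈ A.domain)
    (heL : (extChartAt 𝓘(ℝ, E) x).symm e ∈ L s) :
    ∃ γ, IsLPath E L s ((extChartAt 𝓘(ℝ, E) x).symm e) γ ∧
      (pathVelocity E γ s : E) =
        mfderiv 𝓘(ℝ, E) 𝓘(ℝ, E) (extChartAt 𝓘(ℝ, E) x).symm e (A.field e) := by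
  set z₀ := A.Θ (e, (s : ℝ)) with hz₀
  have hz₀t : z₀ ∈ A.Θ.target := A.Θ.map_source he
  have hz₀F : z₀ ∈ A.F := (A.slice _ he s.2).1 heL
  have hℓ : A.ℓ z₀ = s := A.ℓ_Θ _ he
  -- As `ℓ z₀ = s` and `ℓ v = 1`, the shift by `s` makes the parameter equal to the time.
  let k : ℝ → E := fun t => A.line z₀ A.v (t - s)
  have hks : k s = e := by
    simp [k, line, hz₀, A.Θ.left_inv he]
  let T : Set ℝ := {t | z₀ + (t - s) • A.v ∈ A.Θ.target}
  have hT : IsOpen T := A.Θ.open_target.preimage (by fun_prop)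
  have hsT : (s : ℝ) ∈ T := by simpa [T] using hz₀t
  have hk : HasDerivAt k (A.field e) s := by
    have h1 : HasDerivAt (A.line z₀ A.v) (A.field e) ((s : ℝ) - s) := by
      rw [sub_self]
      exact A.hasDerivAt_line hz₀t
    simpa using h1.comp_sub_const (s : ℝ) (s : ℝ)
  refine ⟨(extChartAt 𝓘(ℝ, E) x).symm ∘ k, ⟨by simp [hks], T, hT.mem_nhds hsT, ?_, ?_⟩, ?_⟩
  · refine ContDiffOn.contMDiffOn_extChartAt_symm_comp ?_ fun t ht => A.line_mem_target ht.2
    exact (A.contDiffOn_line z₀ A.v).comp (by fun_prop) fun t ht => ht.2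
  · intro t ht htT
    exact A.line_mem htT hz₀F A.v_mem (by rw [hℓ, A.ℓ_v]; ring) ht
  · have := mfderivWithin_extChartAt_symm_comp (hk.hasDerivWithinAt (s := J))
      (hks ▸ A.domain_subset he) (hJ s s.2)
    rw [hks] at this
    exact this

/-- The velocities of two paths in the family which pass through `x` at time `s` differ by a vector
that is tangent to `L s`. -/
theorem pathVelocity_sub_mem [FiniteDimensional ℝ E] (A : AdaptedChart E L s x)
    (hJ : UniqueDiffOn ℝ J) {γ₁ γ₂ : ℝ → P}
    (h₁ : IsLPath E L s x γ₁) (h₂ : IsLPath E L s x γ₂) {v₁ v₂ : TangentSpace 𝓘(ℝ, E) x}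
    (hv₁ : v₁ = pathVelocity E γ₁ s) (hv₂ : v₂ = pathVelocity E γ₂ s) :
    v₁ - v₂ ∈ tangentSub 𝓘(ℝ, E) (L s) x := by
  obtain ⟨w₁, hw₁⟩ : ∃ w : E, w = v₁ := ⟨_, rfl⟩
  obtain ⟨w₂, hw₂⟩ : ∃ w : E, w = v₂ := ⟨_, rfl⟩
  have hw₁₂ : w₁ - w₂ = v₁ - v₂ := by rw [hw₁, hw₂]; rfl
  rw [← hw₁₂]
  rw [hv₁] at hw₁
  rw [hv₂] at hw₂
  obtain ⟨e, he⟩ : ∃ e, e = extChartAt 𝓘(ℝ, E) x x := ⟨_, rfl⟩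
  have hmem : (e, (s : ℝ)) ∈ A.Θ.source := he ▸ A.mem
  set z₀ := A.Θ (e, (s : ℝ)) with hz₀
  have hz₀t : z₀ ∈ A.Θ.target := A.Θ.map_source hmem
  have hx : (extChartAt 𝓘(ℝ, E) x).symm e = x := he ▸ extChartAt_to_inv x
  have hΘ : HasFDerivAt A.Θ (fderiv ℝ A.Θ (e, (s : ℝ))) (e, (s : ℝ)) :=
    ((A.smooth.contDiffAt (A.Θ.open_source.mem_nhds hmem)).differentiableAt
      (by simp)).hasFDerivAt
  have hΘs : HasFDerivAt A.Θ.symm (fderiv ℝ A.Θ.symm z₀) z₀ :=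
    ((A.smooth_symm.contDiffAt (A.Θ.open_target.mem_nhds hz₀t)).differentiableAt
      (by simp)).hasFDerivAt
  have hinv : ∀ v, fderiv ℝ A.Θ.symm z₀ (fderiv ℝ A.Θ (e, (s : ℝ)) v) = v := fun v => by
    have h1 := hΘs.comp (e, (s : ℝ)) hΘ
    have h2 : HasFDerivAt (A.Θ.symm ∘ A.Θ) (ContinuousLinearMap.id ℝ (E × ℝ)) (e, (s : ℝ)) :=
      (hasFDerivAt_id _).congr_of_eventuallyEq (A.Θ.eventually_left_inverse hmem)
    exact congrArg (fun T : E × ℝ →L[ℝ] E × ℝ => T v) (h1.unique h2)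
  have hℓ : ∀ v, A.ℓ (fderiv ℝ A.Θ (e, (s : ℝ)) v) = v.2 := fun v => by
    have h1 := (A.ℓ.hasFDerivAt (x := z₀)).comp (e, (s : ℝ)) hΘ
    have h2 : HasFDerivAt (A.ℓ ∘ A.Θ) (ContinuousLinearMap.snd ℝ E ℝ) (e, (s : ℝ)) :=
      ((ContinuousLinearMap.snd ℝ E ℝ).hasFDerivAt).congr_of_eventuallyEq
        (Filter.eventuallyEq_of_mem (A.Θ.open_source.mem_nhds hmem) fun q hq => A.ℓ_Θ q hq)
    exact congrArg (fun T : E × ℝ →L[ℝ] ℝ => T v) (h1.unique h2)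
  -- The curve `(γ t, t)` runs in the total space and has velocity `(w, 1)`.
  have hvel : ∀ γ, IsLPath E L s x γ → ∀ w : E, w = pathVelocity E γ s →
      fderiv ℝ A.Θ (e, (s : ℝ)) (w, 1) ∈ A.F := by
    rintro γ ⟨hγs, U, hU, hγ, hγL⟩ w hw
    have hmd : MDifferentiableWithinAt 𝓘(ℝ, ℝ) 𝓘(ℝ, E) γ J s :=
      ((hγ s ⟨s.2, mem_of_mem_nhds hU⟩).mdifferentiableWithinAt (by simp)).mono_of_mem_nhdsWithin
        (Filter.inter_mem self_mem_nhdsWithin (mem_nhdsWithin_of_mem_nhds hU))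
    have h1 : HasDerivWithinAt (fun t => ((extChartAt 𝓘(ℝ, E) x ∘ γ) t, t))
        (w, (1 : ℝ)) J s := by
      refine HasDerivWithinAt.prodMk ?_ (hasDerivWithinAt_id _ _)
      rw [hw]
      exact hasDerivWithinAt_extChartAt_comp hγs hmd
    have hs : (e, (s : ℝ)) = ((extChartAt 𝓘(ℝ, E) x ∘ γ) s, (s : ℝ)) := by
      rw [Function.comp_apply, hγs, he]
    have hΘ' := hΘ
    rw [hs] at hΘ'
    have h2 := HasFDerivAt.comp_hasDerivWithinAt
      (f := fun t => ((extChartAt 𝓘(ℝ, E) x ∘ γ) t, t)) (s : ℝ) hΘ' h1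
    rw [← hs] at h2
    refine h2.mem_of_forall_mem (hJ s s.2) s.2 ?_
    have hsrc : A.Θ.source ∈ 𝓝 ((extChartAt 𝓘(ℝ, E) x ∘ γ) s, (s : ℝ)) :=
      hs ▸ A.Θ.open_source.mem_nhds hmem
    have hch : (extChartAt 𝓘(ℝ, E) x).source ∈ 𝓝 (γ s) := hγs ▸ extChartAt_source_mem_nhds x
    filter_upwards [h1.continuousWithinAt hsrc, hmd.continuousWithinAt hch,
      mem_nhdsWithin_of_mem_nhds hU, self_mem_nhdsWithin] with t ht ht' htU htJ
    refine (A.slice _ ht htJ).1 ?_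
    have h3 := hγL t htJ htU
    rw [← (extChartAt 𝓘(ℝ, E) x).left_inv ht'] at h3
    exact h3
  let w : E := w₁ - w₂
  -- The time components of `(w₁, 1)` and `(w₂, 1)` cancel, so `u` lies in `F` and in the kernel of
  -- `ℓ`.
  set u := fderiv ℝ A.Θ (e, (s : ℝ)) (w, 0) with hu
  have huF : u ∈ A.F := by
    have := A.F.sub_mem (hvel γ₁ h₁ w₁ hw₁) (hvel γ₂ h₂ w₂ hw₂)
    rwa [← map_sub, Prod.mk_sub_mk, sub_self] at this
  have hℓu : A.ℓ u = 0 := hℓ (w, 0)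
  have hℓz : A.ℓ z₀ = s := A.ℓ_Θ _ hmem
  have hz₀F : z₀ ∈ A.F := (A.slice _ hmem s.2).1 (by
    rw [hx, ← h₁.1]
    exact h₁.2.choose_spec.2.2 s s.2 (mem_of_mem_nhds h₁.2.choose_spec.1))
  have hd : HasDerivAt (A.line z₀ u) w 0 := by
    have := A.hasDerivAt_line (u := u) hz₀t
    rwa [hu, hinv] at this
  have h0 : A.line z₀ u 0 = e := by
    simp only [line, hz₀, zero_smul, add_zero, A.Θ.left_inv hmem]
  obtain ⟨ε, hε, hball⟩ := Metric.isOpen_iff.1 (A.isOpen_line z₀ u) 0 (by simpa using hz₀t)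
  have hIco : Ico 0 ε ⊆ {t : ℝ | z₀ + t • u ∈ A.Θ.target} := fun t ht => hball (by
    rw [Metric.mem_ball, Real.dist_eq, sub_zero, abs_of_nonneg ht.1]
    exact ht.2)
  -- The line along `u` never leaves time `s`, so this curve stays in `L s`; its initial velocity is
  -- `w₁ - w₂`.
  let δ : ℝ → P := (extChartAt 𝓘(ℝ, E) x).symm ∘ A.line z₀ u
  have hδ0 : δ 0 = x := by simp only [δ, Function.comp_apply, h0, hx]
  have hδ : IsCurveIn 𝓘(ℝ, E) (L s) x δ := by
    refine ⟨hδ0, ε, hε, ?_, ?_⟩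
    · exact ContDiffOn.contMDiffOn_extChartAt_symm_comp ((A.contDiffOn_line z₀ u).mono hIco)
        fun t ht => A.line_mem_target (hIco ht)
    · intro t ht
      exact A.line_mem (hIco ht) hz₀F huF (by rw [hℓz, hℓu]; ring) s.2
  refine Submodule.subset_span ⟨δ, hδ, ?_⟩
  obtain ⟨w', hw'⟩ : ∃ w' : E, w' = initialVelocity 𝓘(ℝ, E) δ := ⟨_, rfl⟩
  have h1 : HasDerivWithinAt (extChartAt 𝓘(ℝ, E) x ∘ δ) w' (Ici 0) 0 := by
    rw [hw']
    exact hasDerivWithinAt_extChartAt_comp hδ0 hδ.mdifferentiableWithinAt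
  have h2 : HasDerivWithinAt (extChartAt 𝓘(ℝ, E) x ∘ δ) w (Ici 0) 0 := by
    refine hd.hasDerivWithinAt.congr_of_eventuallyEq_of_mem ?_ self_mem_Ici
    filter_upwards [Ico_mem_nhdsGE hε] with t ht
    exact (extChartAt 𝓘(ℝ, E) x).right_inv (A.line_mem_target (hIco ht))
  exact (uniqueDiffOn_Ici (0 : ℝ) 0 self_mem_Ici).eq_deriv _ h2 h1 |>.trans hw'

end AdaptedChart

/-! ### Contraction of two-forms with vectors. -/

section Contraction

variable {G : Type*} [AddCommGroup G] [Module ℝ G] [TopologicalSpace G]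

/-- The linear form `α(v, ·)`. -/
def contractTwoFormLeft (α : G [⋀^Fin 2]→L[ℝ] ℝ) (v : G) : G →ₗ[ℝ] ℝ :=
  α.toMultilinearMap.toLinearMap ![v, 0] 1

/-- The linear form `α(·, u)`. -/
def contractTwoFormRight (α : G [⋀^Fin 2]→L[ℝ] ℝ) (u : G) : G →ₗ[ℝ] ℝ :=
  α.toMultilinearMap.toLinearMap ![0, u] 0

@[simp]
theorem contractTwoFormLeft_apply (α : G [⋀^Fin 2]→L[ℝ] ℝ) (v u : G) :
    contractTwoFormLeft α v u = α ![v, u] := by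
  have : Function.update ![v, 0] 1 u = ![v, u] := by
    ext i; fin_cases i <;> rfl
  exact congrArg α this

@[simp]
theorem contractTwoFormRight_apply (α : G [⋀^Fin 2]→L[ℝ] ℝ) (v u : G) :
    contractTwoFormRight α u v = α ![v, u] := by
  have : Function.update ![0, u] 0 v = ![v, u] := by
    ext i; fin_cases i <;> rfl
  exact congrArg α this

theorem twoForm_apply_sub_left (α : G [⋀^Fin 2]→L[ℝ] ℝ) (v w u : G) :
    α ![v - w, u] = α ![v, u] - α ![w, u] := by
  simp only [← contractTwoFormRight_apply, map_sub]

theorem contDiffOn_contractTwoFormLeft {E : Type*} [NormedAddCommGroup E] [NormedSpace ℝ E]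
    [FiniteDimensional ℝ E] {α : E → E [⋀^Fin 2]→L[ℝ] ℝ} {w : E → E} {O : Set E}
    (hα : ContDiffOn ℝ ∞ α O) (hw : ContDiffOn ℝ ∞ w O) :
    ContDiffOn ℝ ∞ (fun e => (contractTwoFormLeft (α e) (w e)).toContinuousLinearMap) O := by
  refine contDiffOn_clm_apply.2 fun u => ?_
  let b := Module.finBasis ℝ E
  -- Expanding `w` in a fixed basis leaves only evaluations of `α` at constant vectors.
  have h : ∀ e, (contractTwoFormLeft (α e) (w e)).toContinuousLinearMap u =
      ∑ i, b.repr (w e) i * α e ![b i, u] := fun e => by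
    rw [LinearMap.coe_toContinuousLinearMap', contractTwoFormLeft_apply, ← contractTwoFormRight_apply]
    conv_lhs => rw [← b.sum_repr (w e)]
    simp only [map_sum, map_smul, contractTwoFormRight_apply, smul_eq_mul]
  simp only [h]
  refine ContDiffOn.sum fun i _ => ContDiffOn.mul ?_ ?_
  · exact (b.coord i).toContinuousLinearMap.contDiff.comp_contDiffOn hw
  · exact (ContinuousAlternatingMap.apply ℝ E ℝ ![b i, u]).contDiff.comp_contDiffOn hα

end Contraction

/-! ### Existence, uniqueness and naturality of variation forms. -/

section VariationForms

variable {E : Type*} [NormedAddCommGroup E] [NormedSpace ℝ E]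
  {P : Type*} [TopologicalSpace P] [ChartedSpace E P]
  {F : Type*} [NormedAddCommGroup F] [NormedSpace ℝ F]
  {B : Type*} [TopologicalSpace B] [ChartedSpace F B]
  {X : HomogeneousSymplecticManifold E P F B} {J : Set ℝ} {L : J → Set P}

/-- Variation forms are computed by the velocity of any path in the family. -/
theorem IsVariationForms.apply_eq {ξ : ∀ s : J, OneFormOn 𝓘(ℝ, E) (L s)}
    (hξ : IsVariationForms X L ξ) {s : J} {x : L s} {γ : ℝ → P} (hγ : IsLPath E L s (x : P) γ)
    {v : TangentSpace 𝓘(ℝ, E) (x : P)} (hv : v = pathVelocity E γ s)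
    (u : tangentSub 𝓘(ℝ, E) (L s) (x : P)) :
    ξ s x u = X.Ω x ![v, u] := by
  obtain ⟨ν, ⟨-, hν⟩, h⟩ := hξ.variation s x
  refine (h v ?_ u).symm
  rw [← hν γ hγ, hv]
  rfl

theorem IsVariationForms.exists_isLPath {ξ : ∀ s : J, OneFormOn 𝓘(ℝ, E) (L s)}
    (hξ : IsVariationForms X L ξ) (s : J) (x : L s) : ∃ γ, IsLPath E L s (x : P) γ := by
  obtain ⟨ν, ⟨h, -⟩, -⟩ := hξ.variation s x
  exact h

theorem IsVariationForms.unique {ξ₁ ξ₂ : ∀ s : J, OneFormOn 𝓘(ℝ, E) (L s)}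
    (h₁ : IsVariationForms X L ξ₁) (h₂ : IsVariationForms X L ξ₂) : ξ₁ = ξ₂ := by
  funext s x
  refine LinearMap.ext fun u => ?_
  obtain ⟨γ, hγ⟩ := h₁.exists_isLPath s x
  rw [h₁.apply_eq hγ rfl u, h₂.apply_eq hγ rfl u]

theorem IsSmoothLagrangianFamily.exists_isLPath [FiniteDimensional ℝ E] [IsManifold 𝓘(ℝ, E) ∞ P]
    (hL : IsSmoothLagrangianFamily X L) (hJ : UniqueDiffOn ℝ J) (s : J) (x : L s) :
    ∃ γ, IsLPath E L s (x : P) γ := by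
  obtain ⟨A⟩ := AdaptedChart.nonempty hL s x
  have hx : (extChartAt 𝓘(ℝ, E) (x : P)).symm (extChartAt 𝓘(ℝ, E) (x : P) x) = x :=
    extChartAt_to_inv _
  obtain ⟨γ, hγ, -⟩ := A.exists_isLPath hJ A.mem (by rw [hx]; exact x.2)
  rw [hx] at hγ
  exact ⟨γ, hγ⟩

/-- Existence of the variation forms. -/
theorem IsSmoothLagrangianFamily.exists_isVariationForms [FiniteDimensional ℝ E]
    [IsManifold 𝓘(ℝ, E) ∞ P] (hL : IsSmoothLagrangianFamily X L) (hJ : UniqueDiffOn ℝ J) :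
    ∃ ξ, IsVariationForms X L ξ := by
  have : IsManifold 𝓘(ℝ, E) 1 P := .of_le (n := ∞) (by simp)
  -- The paths are chosen pointwise, with no regularity in `x`; `hv` and `hΩ` show that the form
  -- does not see the choice.
  choose γ hγ using fun (s : J) (x : L s) => hL.exists_isLPath hJ s x
  let v : ∀ (s : J) (x : L s), TangentSpace 𝓘(ℝ, E) (x : P) := fun s x => pathVelocity E (γ s x) s
  have hv : ∀ (s : J) (x : L s) (γ' : ℝ → P), IsLPath E L s (x : P) γ' →
      ∀ v' : TangentSpace 𝓘(ℝ, E) (x : P), v' = pathVelocity E γ' s →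
        v' - v s x ∈ tangentSub 𝓘(ℝ, E) (L s) (x : P) := fun s x γ' hγ' v' hv' => by
    obtain ⟨A⟩ := AdaptedChart.nonempty hL s x
    exact A.pathVelocity_sub_mem hJ hγ' (hγ s x) hv' rfl
  -- Changing the representative by a tangent vector has no effect, as `L s` is isotropic.
  have hΩ : ∀ (s : J) (x : L s) (v' : TangentSpace 𝓘(ℝ, E) (x : P)),
      v' - v s x ∈ tangentSub 𝓘(ℝ, E) (L s) (x : P) →
      ∀ u : tangentSub 𝓘(ℝ, E) (L s) (x : P), X.Ω x ![v', u] = X.Ω x ![v s x, u] :=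
    fun s x v' hv' u => by
      have := (hL.lagrangian s).isotropic x x.2 _ hv' u u.2
      rwa [twoForm_apply_sub_left, sub_eq_zero] at this
  refine ⟨fun s x => (contractTwoFormLeft (X.Ω x) (v s x)).comp (Submodule.subtype _), ?_, ?_⟩
  · intro s p
    obtain ⟨A⟩ := AdaptedChart.nonempty hL s p
    -- Near `p` the form is the restriction of an ambient one: `Ω` in the chart, contracted with the
    -- smooth variation field.
    refine ⟨A.domain, fun e => (contractTwoFormLeft (formInChart X.Ω (p : P) e)
      (A.field e)).toContinuousLinearMap, A.isOpen_domain, A.mem,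
      contDiffOn_contractTwoFormLeft ((X.symplectic.smooth p).mono A.domain_subset) A.contDiffOn_field, ?_⟩
    have key : ∀ e ∈ A.domain, ∀ (y : L s), (y : P) = (extChartAt 𝓘(ℝ, E) (p : P)).symm e →
        ∀ u : tangentSub 𝓘(ℝ, E) (L s) (y : P),
        X.Ω y ![v s y, u] = formInChart X.Ω (p : P) e ![A.field e,
          mfderiv 𝓘(ℝ, E) 𝓘(ℝ, E) (extChartAt 𝓘(ℝ, E) (p : P)) y u] := by
      rintro e he ⟨y, hy⟩ (rfl : y = _) u
      -- At points of `L s` the field is the velocity of a path, so it may replace the chosen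
      -- representative.
      obtain ⟨γ', hγ', hv'⟩ := A.exists_isLPath hJ he hy
      have h1 := mfderivWithin_extChartAt_symm_comp_mfderiv_extChartAt (A.domain_subset he)
      rw [ModelWithCorners.range_eq_univ, mfderivWithin_univ] at h1
      have h2 := DFunLike.congr_fun h1 (u : TangentSpace 𝓘(ℝ, E) _)
      rw [← hΩ s ⟨_, hy⟩ _ (hv s ⟨_, hy⟩ γ' hγ' _ hv'.symm) u]
      simp only [formInChart, pullbackForm]
      refine congrArg (X.Ω _) ?_
      ext i
      fin_cases i
      · rfl
      · exact h2.symm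
    intro q hq hqO u
    exact (contractTwoFormLeft_apply _ _ _).trans
      ((key _ hqO q ((extChartAt 𝓘(ℝ, E) (p : P)).left_inv hq).symm u).trans
        (contractTwoFormLeft_apply _ _ _).symm)
  · intro s x
    refine ⟨Submodule.Quotient.mk (v s x), ⟨⟨γ s x, hγ s x⟩, fun γ' hγ' => ?_⟩, fun v' hv' u => ?_⟩
    · exact (Submodule.Quotient.eq _).2 (hv s x γ' hγ' _ rfl)
    · rw [LinearMap.comp_apply, contractTwoFormLeft_apply, Submodule.subtype_apply]
      exact hΩ s x v' ((Submodule.Quotient.eq _).1 hv') u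

theorem IsSmoothLagrangianFamily.existsUnique_isVariationForms [FiniteDimensional ℝ E]
    [IsManifold 𝓘(ℝ, E) ∞ P] (hL : IsSmoothLagrangianFamily X L) (hJ : UniqueDiffOn ℝ J) :
    ∃! ξ, IsVariationForms X L ξ := by
  obtain ⟨ξ, hξ⟩ := hL.exists_isVariationForms hJ
  exact ⟨ξ, hξ, fun _ h => h.unique hξ⟩

variable {E' : Type*} [NormedAddCommGroup E'] [NormedSpace ℝ E']
  {P' : Type*} [TopologicalSpace P'] [ChartedSpace E' P']
  {F' : Type*} [NormedAddCommGroup F'] [NormedSpace ℝ F']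
  {B' : Type*} [TopologicalSpace B'] [ChartedSpace F' B']
  {X' : HomogeneousSymplecticManifold E' P' F' B'} {L' : J → Set P'}

theorem IsLPath.comp {f : P → P'} (hf : ContMDiff 𝓘(ℝ, E) 𝓘(ℝ, E') ∞ f)
    (hL : ∀ s, MapsTo f (L s) (L' s)) {s : J} {x : P} {γ : ℝ → P} (hγ : IsLPath E L s x γ) :
    IsLPath E' L' s (f x) (f ∘ γ) := by
  obtain ⟨h0, U, hU, hs, hm⟩ := hγ
  exact ⟨congrArg f h0, U, hU, hf.comp_contMDiffOn hs, fun t ht htU => hL _ (hm t ht htU)⟩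

theorem IsLPath.pathVelocity_comp {f : P → P'} (hf : ContMDiff 𝓘(ℝ, E) 𝓘(ℝ, E') ∞ f)
    (hJ : UniqueDiffOn ℝ J) {s : J} {x : P} {γ : ℝ → P} (hγ : IsLPath E L s x γ) :
    pathVelocity E' (f ∘ γ) s = mfderiv 𝓘(ℝ, E) 𝓘(ℝ, E') f (γ s) (pathVelocity E γ s) := by
  obtain ⟨h0, U, hU, hs, -⟩ := hγ
  have hmd : MDifferentiableWithinAt 𝓘(ℝ, ℝ) 𝓘(ℝ, E) γ J s :=
    ((hs s ⟨s.2, mem_of_mem_nhds hU⟩).mdifferentiableWithinAt (by simp)).mono_of_mem_nhdsWithin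
      (Filter.inter_mem self_mem_nhdsWithin (mem_nhdsWithin_of_mem_nhds hU))
  have h1 : MDifferentiableAt 𝓘(ℝ, E) 𝓘(ℝ, E') f (γ s) := (hf (γ s)).mdifferentiableAt (by simp)
  have := mfderiv_comp_mfderivWithin (s : ℝ) h1 hmd (hJ s s.2).uniqueMDiffWithinAt
  exact congrArg (fun T : ℝ →L[ℝ] E' => T 1) this

/-- Naturality of the variation forms under maps which preserve the families and scale the
symplectic forms. -/
theorem IsVariationForms.pullbackOneForm_eq {f : P → P'} (hf : ContMDiff 𝓘(ℝ, E) 𝓘(ℝ, E') ∞ f)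
    (hJ : UniqueDiffOn ℝ J) (hL : ∀ s, MapsTo f (L s) (L' s)) {c : ℝ}
    (hΩ : ∀ x, pullbackForm f X'.Ω x = c • X.Ω x)
    {ξ : ∀ s : J, OneFormOn 𝓘(ℝ, E) (L s)} {ξ' : ∀ s : J, OneFormOn 𝓘(ℝ, E') (L' s)}
    (hξ : IsVariationForms X L ξ) (hξ' : IsVariationForms X' L' ξ') (s : J) :
    pullbackOneForm hf (hL s) (ξ' s) = c • ξ s := by
  funext x
  refine LinearMap.ext fun u => ?_
  obtain ⟨γ, hγ⟩ := hξ.exists_isLPath s x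
  obtain ⟨x, hx⟩ := x
  -- This places the velocity and the form at literally the same point.
  obtain rfl : γ s = x := hγ.1
  have h1 := hξ'.apply_eq (x := ⟨f (γ s), hL s hx⟩) (hγ.comp hf hL)
    (hγ.pathVelocity_comp hf hJ).symm
    ⟨mfderiv 𝓘(ℝ, E) 𝓘(ℝ, E') f (γ s) u, mfderiv_mem_tangentSub hf (hL s) u.2⟩
  have h2 := hξ.apply_eq hγ rfl u
  have h3 : pullbackForm f X'.Ω (γ s) ![pathVelocity E γ s, u] =
      c * X.Ω (γ s) ![pathVelocity E γ s, u] := by rw [hΩ]; rfl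
  refine h1.trans (Eq.trans ?_ (h3.trans (congrArg (c * ·) h2.symm)))
  refine congrArg (X'.Ω _) ?_
  ext i
  fin_cases i <;> rfl

end VariationForms

/-! ### Images of submanifolds under diffeomorphisms. -/

section Images

variable {E : Type*} [NormedAddCommGroup E] [NormedSpace ℝ E] {H : Type*} [TopologicalSpace H]
  {I : ModelWithCorners ℝ E H} [I.Boundaryless]
  {M : Type*} [TopologicalSpace M] [ChartedSpace H M]
  {E' : Type*} [NormedAddCommGroup E'] [NormedSpace ℝ E'] {H' : Type*} [TopologicalSpace H']
  {I' : ModelWithCorners ℝ E' H'} [I'.Boundaryless]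
  {M' : Type*} [TopologicalSpace M'] [ChartedSpace H' M'] [IsManifold I' ∞ M']

/-- Diffeomorphisms map submanifolds to submanifolds. -/
theorem IsSubmanifoldIn.image (Φ : M ≃ₘ⟮I, I'⟯ M') {D : Set M} {D' : Set M'}
    (hD : ∀ q, Φ q ∈ D' ↔ q ∈ D) {k : ℕ} {S : Set M} (hS : IsSubmanifoldIn I D k S) :
    IsSubmanifoldIn I' D' k (Φ '' S) := by
  refine ⟨?_, ?_⟩
  · rintro _ ⟨q, hq, rfl⟩
    exact (hD q).2 (hS.1 hq)
  rintro _ ⟨p, hp, rfl⟩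
  obtain ⟨φ, hφ, hpφ, F, hFk, hF⟩ := hS.2 p hp
  -- Any linear isomorphism would do: it only transports the values of `φ` to the model space of
  -- `M'`, taking `F` to a subspace of the same dimension.
  let A : E ≃L[ℝ] E' := Φ.mfderivToContinuousLinearEquiv (by simp) p
  let h : H ≃ₜ H' := (I.toHomeomorph.trans A.toHomeomorph).trans I'.toHomeomorph.symm
  let ψ : OpenPartialHomeomorph M' H' :=
    (Φ.symm.toHomeomorph.toOpenPartialHomeomorph.trans φ).trans h.toOpenPartialHomeomorph
  have hh : ContMDiff I I' ∞ h := by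
    have h1 : ContMDiff 𝓘(ℝ, E') I' ∞ I'.symm := by
      have := I'.contMDiffOn_symm (n := ∞)
      rwa [I'.range_eq_univ, contMDiffOn_univ] at this
    exact h1.comp (A.contDiff.contMDiff.comp I.contMDiff)
  have hh' : ContMDiff I' I ∞ h.symm := by
    have h1 : ContMDiff 𝓘(ℝ, E) I ∞ I.symm := by
      have := I.contMDiffOn_symm (n := ∞)
      rwa [I.range_eq_univ, contMDiffOn_univ] at this
    exact h1.comp (A.symm.contDiff.contMDiff.comp I'.contMDiff)
  have hψ : ψ ∈ IsManifold.maximalAtlas I' ∞ M' := by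
    refine ψ.mem_maximalAtlas_of_contMDiffOn ?_ ?_
    · refine hh.comp_contMDiffOn ((contMDiffOn_of_mem_maximalAtlas hφ).comp
        Φ.symm.contMDiff.contMDiffOn fun q hq => ?_)
      exact hq.1.2
    · refine Φ.contMDiff.comp_contMDiffOn ((contMDiffOn_symm_of_mem_maximalAtlas hφ).comp
        hh'.contMDiffOn fun q hq => ?_)
      exact hq.2.1
  have hsrc : ∀ q, q ∈ ψ.source ↔ Φ.symm q ∈ φ.source := fun q => by
    simp [ψ]
  have hext : ∀ q, ψ.extend I' q = A (φ.extend I (Φ.symm q)) := fun q =>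
    I'.right_inv (by rw [I'.range_eq_univ]; trivial)
  refine ⟨ψ, hψ, (hsrc _).2 (by simpa using hpφ), F.map (A : E →ₗ[ℝ] E'), ?_, ?_⟩
  · rw [← hFk]
    exact LinearEquiv.finrank_map_eq A.toLinearEquiv F
  · intro q hq hqD
    obtain ⟨q, rfl⟩ : ∃ r, Φ r = q := ⟨Φ.symm q, Φ.apply_symm_apply q⟩
    rw [hsrc, Φ.symm_apply_apply] at hq
    rw [Function.Injective.mem_set_image (f := Φ) Φ.injective, hF q hq ((hD q).1 hqD), hext, Φ.symm_apply_apply]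
    exact (Function.Injective.mem_set_image A.injective (s := (F : Set E))).symm

end Images

/-! ### Images of Lagrangian families under a homogeneous symplectomorphism. -/

section ImageFamily

variable {E : Type*} [NormedAddCommGroup E] [NormedSpace ℝ E]
  {P : Type*} [TopologicalSpace P] [ChartedSpace E P]
  {F : Type*} [NormedAddCommGroup F] [NormedSpace ℝ F]
  {B : Type*} [TopologicalSpace B] [ChartedSpace F B]
  {E' : Type*} [NormedAddCommGroup E'] [NormedSpace ℝ E']
  {P' : Type*} [TopologicalSpace P'] [ChartedSpace E' P']
  {F' : Type*} [NormedAddCommGroup F'] [NormedSpace ℝ F']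
  {B' : Type*} [TopologicalSpace B'] [ChartedSpace F' B']
  {V : HomogeneousSymplecticManifold E P F B} {W : HomogeneousSymplecticManifold E' P' F' B'}
  {φ : P ≃ₘ⟮𝓘(ℝ, E), 𝓘(ℝ, E')⟯ P'}

theorem familyTotal_image {J : Set ℝ} (L : J → Set P) :
    familyTotal (fun s => φ '' L s) =
      (φ.prodCongr (Diffeomorph.refl 𝓘(ℝ, ℝ) ℝ ∞)) '' familyTotal L := by
  ext ⟨y, t⟩
  constructor
  · rintro ⟨ht, x, hx, hxy⟩
    exact ⟨(x, t), ⟨ht, hx⟩, Prod.ext hxy rfl⟩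
  · rintro ⟨⟨x, r⟩, ⟨hr, hx⟩, hxy⟩
    obtain ⟨h1, h2⟩ := Prod.ext_iff.1 hxy
    obtain rfl : φ x = y := h1
    obtain rfl : r = t := h2
    exact ⟨hr, x, hx, rfl⟩

theorem IsSmoothLagrangianFamily.nonempty {J : Set ℝ} {L : J → Set P}
    (hL : IsSmoothLagrangianFamily V L) (s : J) : (L s).Nonempty := by
  obtain ⟨⟨x, t⟩, ⟨ht, hx⟩, hts⟩ := hL.surjective s s.2
  obtain rfl : t = s := hts
  exact ⟨x, hx⟩

variable [IsManifold 𝓘(ℝ, E') ∞ P']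

theorem IsHomogeneousLagrangian.image (hφ : IsHomogeneousSymplectomorphism V W φ) {L : Set P}
    (hL : IsHomogeneousLagrangian V L) (hne : L.Nonempty) : IsHomogeneousLagrangian W (φ '' L) := by
  refine ⟨?_, ?_, ?_⟩
  · obtain ⟨n, hn, hs⟩ := hL.submanifold
    -- A point is needed because the dimensions of `E` and `E'` are compared through the derivative
    -- of `φ` there.
    obtain ⟨p, -⟩ := hne
    let A : E ≃L[ℝ] E' := φ.mfderivToContinuousLinearEquiv (by simp) p
    exact ⟨n, A.toLinearEquiv.finrank_eq ▸ hn, hs.image φ fun _ => by simp⟩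
  · rintro _ ⟨x, hx, rfl⟩ u hu v hv
    have hm : MapsTo φ.symm (φ '' L) L := by
      rintro _ ⟨y, hy, rfl⟩
      simpa using hy
    let A := φ.mfderivToContinuousLinearEquiv (by simp) x
    -- Every tangent vector of the image comes from one of `L`: the differential of `φ.symm` sends
    -- it back.
    have hA : ∀ w ∈ tangentSub 𝓘(ℝ, E') (φ '' L) (φ x),
        ∃ w' ∈ tangentSub 𝓘(ℝ, E) L x, mfderiv 𝓘(ℝ, E) 𝓘(ℝ, E') φ x w' = w := fun w hw => by
      obtain ⟨w', rfl⟩ := A.surjective w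
      refine ⟨w', ?_, rfl⟩
      have h1 := mfderiv_mem_tangentSub φ.symm.contMDiff hm hw
      rw [φ.symm_apply_apply] at h1
      have h2 := mfderiv_comp x ((φ.symm.contMDiff (φ x)).mdifferentiableAt (by simp))
        ((φ.contMDiff x).mdifferentiableAt (by simp))
      have h3 : φ.symm ∘ φ = id := funext φ.symm_apply_apply
      rw [h3, mfderiv_id] at h2
      have h4 : w' = mfderiv 𝓘(ℝ, E') 𝓘(ℝ, E) φ.symm (φ x) (A w') := DFunLike.congr_fun h2 w'
      rw [h4]
      exact h1
    obtain ⟨u', hu', rfl⟩ := hA u hu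
    obtain ⟨v', hv', rfl⟩ := hA v hv
    have h1 := hL.isotropic x hx u' hu' v' hv'
    rw [← hφ.symplectic] at h1
    refine Eq.trans (congrArg (W.Ω (φ x)) ?_) h1
    ext i
    fin_cases i <;> rfl
  · rintro z _ ⟨x, hx, rfl⟩
    exact ⟨V.h z x, hL.invariant z hx, hφ.equivariant z x⟩

theorem IsSmoothLagrangianFamily.image (hφ : IsHomogeneousSymplectomorphism V W φ) {J : Set ℝ}
    {L : J → Set P} (hL : IsSmoothLagrangianFamily V L) :
    IsSmoothLagrangianFamily W (fun s => φ '' L s) := by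
  refine ⟨fun s => (hL.lagrangian s).image hφ (hL.nonempty s), ?_, ?_, ?_⟩
  · obtain ⟨d, hd⟩ := hL.submanifold
    refine ⟨d, ?_⟩
    rw [familyTotal_image]
    exact hd.image _ fun q => Iff.rfl
  · intro s hs
    obtain ⟨x, hx⟩ := hL.nonempty ⟨s, hs⟩
    exact ⟨(φ x, s), ⟨hs, x, hx, rfl⟩, rfl⟩
  · intro q hq c
    rw [familyTotal_image] at hq ⊢
    obtain ⟨p, hp, rfl⟩ := hq
    obtain ⟨v, hv, hvc⟩ := hL.submersion p hp c
    set Φ := φ.prodCongr (Diffeomorph.refl 𝓘(ℝ, ℝ) ℝ ∞) with hΦ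
    -- `φ × id` does not change the time component, so transporting `v` proves the submersion
    -- condition.
    refine ⟨mfderiv (𝓘(ℝ, E).prod 𝓘(ℝ, ℝ)) (𝓘(ℝ, E').prod 𝓘(ℝ, ℝ)) Φ p v,
      mfderiv_mem_tangentSub Φ.contMDiff (mapsTo_image _ _) hv, ?_⟩
    have h1 : MDifferentiableAt (𝓘(ℝ, E).prod 𝓘(ℝ, ℝ)) (𝓘(ℝ, E').prod 𝓘(ℝ, ℝ)) Φ p :=
      (Φ.contMDiff p).mdifferentiableAt (by simp)
    have h2 : MDifferentiableAt (𝓘(ℝ, E').prod 𝓘(ℝ, ℝ)) 𝓘(ℝ, ℝ) (Prod.snd : P' × ℝ → ℝ) (Φ p) :=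
      mdifferentiableAt_snd
    have h3 := mfderiv_comp p h2 h1
    have h4 : (Prod.snd : P' × ℝ → ℝ) ∘ Φ = Prod.snd := rfl
    rw [h4] at h3
    exact (DFunLike.congr_fun h3 v).symm.trans hvc

end ImageFamily

end

/-! ### The proposition. -/

theorem mainTheorem8
    {E : Type*} [NormedAddCommGroup E] [NormedSpace ℝ E] [FiniteDimensional ℝ E]
    {P : Type*} [TopologicalSpace P] [ChartedSpace E P] [IsManifold 𝓘(ℝ, E) ∞ P]
    {F : Type*} [NormedAddCommGroup F] [NormedSpace ℝ F] [FiniteDimensional ℝ F]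
    {B : Type*} [TopologicalSpace B] [ChartedSpace F B] [IsManifold 𝓘(ℝ, F) ∞ B]
    {E' : Type*} [NormedAddCommGroup E'] [NormedSpace ℝ E'] [FiniteDimensional ℝ E']
    {P' : Type*} [TopologicalSpace P'] [ChartedSpace E' P'] [IsManifold 𝓘(ℝ, E') ∞ P']
    {F' : Type*} [NormedAddCommGroup F'] [NormedSpace ℝ F'] [FiniteDimensional ℝ F']
    {B' : Type*} [TopologicalSpace B'] [ChartedSpace F' B'] [IsManifold 𝓘(ℝ, F') ∞ B']
    (V : HomogeneousSymplecticManifold E P F B) (W : HomogeneousSymplecticManifold E' P' F' B')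
    (φ : P ≃ₘ⟮𝓘(ℝ, E), 𝓘(ℝ, E')⟯ P') (hφ : IsHomogeneousSymplectomorphism V W φ)
    {J : Set ℝ} (hJ : J.OrdConnected) (hJ' : J.Nontrivial)
    (L : J → Set P) (hL : IsSmoothLagrangianFamily V L) :
    (∃! ξ : ∀ s : J, OneFormOn 𝓘(ℝ, E) (L s), IsVariationForms V L ξ) ∧
    (∃! ξ' : ∀ s : J, OneFormOn 𝓘(ℝ, E') (φ '' L s),
      IsVariationForms W (fun s => φ '' L s) ξ') ∧
    ∃ hL' : IsSmoothLagrangianFamily W (fun s => φ '' L s),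
      ∀ (ξ : ∀ s : J, OneFormOn 𝓘(ℝ, E) (L s)) (ξ' : ∀ s : J, OneFormOn 𝓘(ℝ, E') (φ '' L s)),
        IsVariationForms V L ξ → IsVariationForms W (fun s => φ '' L s) ξ' →
        ∀ s : J,
          IsOneHomogeneous V.toHomogeneousManifold (hL.lagrangian s).invariant (ξ s) ∧
          IsOneHomogeneous W.toHomogeneousManifold (hL'.lagrangian s).invariant (ξ' s) ∧
          ξ s = pullbackOneForm φ.contMDiff (mapsTo_image φ (L s)) (ξ' s) := by
  -- A convex set with nonempty interior has unique derivatives, also at end points; the midpoint of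
  -- two distinct points of `J` is interior.
  have hJu : UniqueDiffOn ℝ J := by
    obtain ⟨a, ha, b, hb, hab⟩ := hJ'.exists_lt
    refine uniqueDiffOn_convex hJ.convex ⟨(a + b) / 2, ?_⟩
    refine interior_mono (hJ.out ha hb) ?_
    rw [interior_Icc]
    exact ⟨by linarith, by linarith⟩
  have hL' := hL.image hφ
  refine ⟨hL.existsUnique_isVariationForms hJu, hL'.existsUnique_isVariationForms hJu, hL', ?_⟩
  intro ξ ξ' hξ hξ' s
  refine ⟨fun z => ?_, fun z => ?_, ?_⟩
  -- The action maps each `L s` to itself and scales `Ω` by `z`, so naturality applies with the same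
  -- forms on both sides.
  · exact IsVariationForms.pullbackOneForm_eq (V.contMDiff_h z) hJu
      (fun s => (hL.lagrangian s).invariant z) (V.homogeneous z) hξ hξ s
  · exact IsVariationForms.pullbackOneForm_eq (W.contMDiff_h z) hJu
      (fun s => (hL'.lagrangian s).invariant z) (W.homogeneous z) hξ' hξ' s
  · have h := IsVariationForms.pullbackOneForm_eq φ.contMDiff hJu
      (fun s => mapsTo_image φ (L s)) (c := 1)
      (fun x => by rw [hφ.symplectic, one_smul]) hξ hξ' s
    rw [one_smul] at h
    exact h.symm
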